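/- Let $X\sim N(0,1)$, let $F$ be the distribution function of $|X|$, and for $p\in(0,1]$ let $z^*=z^*(p)\ge 0$ be the unique number with $E\big[|X|^p\mathbf 1_{\{|X|>z^*\}}\big]=\tfrac12 E|X|^p$. Put $\rho^*(p)=1-F(z^*)$. Theorem. For every $p\in(0,1]$ and every real $\rho<\rho^*(p)$ there exist constants $c_4,c_5>0$ and an integer $N$, depending only on $p$ and $\rho$, such that for all integers $n\ge N$ and $m\ge c_4 n$ the following holds for a random $m\times n$ matrix $A$ with i.i.d. $N(0,1)$ entries. With probability at least $1-e^{-c_5 n}$, the matrix $A$ has this property: for every $f\in\mathbf R^n$ and every $e\in\mathbf R^m$ whose support $\{i: e_i\ne 0\}$ has at most $\rho m$ elements, $f$ is the unique minimizer over $x\in\mathbf R^n$ of $\|y-Ax\|_p^p=\sum_{i=1}^m |y_i-(Ax)_i|^p$, where $y=Af+e$. -/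

import Mathlib

open MeasureTheory ProbabilityTheory Filter Topology Set

noncomputable section

/-- The law of `|X|` for a standard Gaussian random variable `X`. -/
def absGaussian : Measure ℝ := (gaussianReal 0 1).map (fun x => |x|)

instance : IsProbabilityMeasure absGaussian :=
  Measure.isProbabilityMeasure_map (by fun_prop)

/-- `gTail p t = E[|X| ^ p ; |X| > t]` for `X ∼ N(0,1)`. -/
def gTail (p t : ℝ) : ℝ := ∫ z in Ioi t, z ^ p ∂absGaussian

/-- The point `z* ≥ 0` that splits the mean of `|X| ^ p`, `X ∼ N(0,1)`, into two equal halves: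
`gTail p z* = gTail p 0 / 2`. For `p > 0` exactly one such point exists
(`existsUnique_split`), so the infimum is over a one-point set. -/
def zStar (p : ℝ) : ℝ := sInf {t : ℝ | 0 ≤ t ∧ gTail p t = gTail p 0 / 2}

/-- The threshold `ρ*(p) = 1 - F(z*)`, with `F` the distribution function of `|X|`,
`X ∼ N(0,1)`. -/
def rhoStar (p : ℝ) : ℝ := 1 - cdf absGaussian (zStar p)

/-- `‖v‖_p^p = ∑ i, |v i| ^ p` (used for `p > 0`). -/
def lpPow {m : ℕ} (p : ℝ) (v : Fin m → ℝ) : ℝ := ∑ i, |v i| ^ p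

/-- `f` is the unique minimizer of `x ↦ ‖y - A x‖_p^p` over all of `ℝⁿ`. -/
def IsUniqueLpSolution {m n : ℕ} (p : ℝ) (A : Matrix (Fin m) (Fin n) ℝ)
    (y : Fin m → ℝ) (f : Fin n → ℝ) : Prop :=
  ∀ x : Fin n → ℝ, x ≠ f → lpPow p (y - A.mulVec f) < lpPow p (y - A.mulVec x)

/-- `A` corrects all errors of relative support size at most `ρ` by `l_p`-minimization: every `f`
is recovered from `A f + e`, for every `e` with at most `ρ m` nonzero entries. -/
def RecoversAll {m n : ℕ} (p ρ : ℝ) (A : Matrix (Fin m) (Fin n) ℝ) : Prop :=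
  ∀ (f : Fin n → ℝ) (e : Fin m → ℝ),
    ({i : Fin m | e i ≠ 0}.ncard : ℝ) ≤ ρ * m →
      IsUniqueLpSolution p A (A.mulVec f + e) f

/-- The random matrix `A` on `(Ω, P)` has independent entries, each with law `N(0,1)`. -/
structure IsStdGaussianMatrix {Ω : Type*} [MeasurableSpace Ω] (P : Measure Ω) {m n : ℕ}
    (A : Ω → Matrix (Fin m) (Fin n) ℝ) : Prop where
  hasLaw : ∀ i j, HasLaw (fun ω => A ω i j) (gaussianReal 0 1) P
  indep : iIndepFun (fun (ij : Fin m × Fin n) (ω : Ω) => A ω ij.1 ij.2) P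

end

instance : NullSingletonClass absGaussian := by
  refine ⟨fun x => ?_⟩
  have := nullSingletonClass_gaussianReal (μ := 0) (v := 1) one_ne_zero
  rw [absGaussian, Measure.map_apply (by fun_prop) (measurableSet_singleton x)]
  refine measure_mono_null (t := {x, -x}) ?_ (Set.Finite.measure_zero (by simp) _)
  intro y hy
  have : |y| = x := hy
  rcases abs_choice y with h | h <;> simp [← this, h]

lemma absGaussian_Ioo_pos {s t : ℝ} (hs : 0 ≤ s) (hst : s < t) : 0 < absGaussian (Ioo s t) := by
  rw [absGaussian, Measure.map_apply (by fun_prop) measurableSet_Ioo]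
  have h1 : (0 : ENNReal) < volume (Ioo s t) := by simp [hst]
  have h2 : gaussianReal 0 1 (Ioo s t) ≠ 0 := fun h =>
    h1.ne' (gaussianReal_absolutelyContinuous' 0 one_ne_zero h)
  refine (pos_iff_ne_zero.2 h2).trans_le (measure_mono fun x hx => ?_)
  have : |x| = x := abs_of_nonneg (hs.trans hx.1.le)
  simpa [this] using hx

lemma integrable_rpow_absGaussian {p : ℝ} (hp : 0 < p) :
    Integrable (fun z : ℝ => z ^ p) absGaussian := by
  rw [absGaussian, integrable_map_measure (by fun_prop) (by fun_prop)]
  have := (memLp_id_gaussianReal' (μ := 0) (v := 1) (ENNReal.ofReal p)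
    ENNReal.ofReal_ne_top).integrable_norm_rpow (by simpa using hp) ENNReal.ofReal_ne_top
  simpa [Function.comp_def, ENNReal.toReal_ofReal hp.le] using this

/-- The point defining the threshold exists and is unique. -/
theorem existsUnique_split {p : ℝ} (hp : 0 < p) :
    ∃! t : ℝ, 0 ≤ t ∧ gTail p t = gTail p 0 / 2 := by
  have hint := integrable_rpow_absGaussian hp
  have hsub : ∀ s t, s ≤ t → gTail p s - gTail p t = ∫ z in s..t, z ^ p ∂absGaussian :=
    fun s t hst => intervalIntegral.integral_Ioi_sub_Ioi hint.integrableOn hst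
  have hanti : ∀ s t, 0 ≤ s → s < t → gTail p t < gTail p s := by
    intro s t hs hst
    rw [← sub_pos, hsub s t hst.le, intervalIntegral.integral_of_le hst.le,
      setIntegral_pos_iff_support_of_nonneg_ae _ hint.integrableOn]
    · refine (absGaussian_Ioo_pos hs hst).trans_le (measure_mono fun x hx => ⟨?_, hx.1, hx.2.le⟩)
      exact (Real.rpow_pos_of_pos (hs.trans_lt hx.1) p).ne'
    · filter_upwards [ae_restrict_mem measurableSet_Ioc] with x hx
      exact Real.rpow_nonneg (hs.trans hx.1.le) p
  set G : ℝ → ℝ := fun t => ∫ z in (0 : ℝ)..t, z ^ p ∂absGaussian with hG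
  have hGg : ∀ t, 0 ≤ t → gTail p t = gTail p 0 - G t := fun t ht => by
    rw [hG]; simp only []; rw [← hsub 0 t ht]; ring
  have hcont : Continuous G :=
    intervalIntegral.continuous_primitive (fun a b => hint.intervalIntegrable) 0
  have hlim : Tendsto G atTop (𝓝 (gTail p 0)) :=
    intervalIntegral_tendsto_integral_Ioi 0 hint.integrableOn tendsto_id
  have hnn : ∀ t, 0 ≤ gTail p (max t 0) := fun t =>
    setIntegral_nonneg measurableSet_Ioi fun x hx =>
      Real.rpow_nonneg ((le_max_right t 0).trans (le_of_lt hx)) p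
  have hpos : 0 < gTail p 0 := by
    have h1 := hanti 0 1 le_rfl one_pos
    have h2 := hnn 1
    simp at h2
    linarith
  obtain ⟨T, hT, hT0⟩ := ((hlim.eventually (lt_mem_nhds (half_lt_self hpos))).and
    (eventually_ge_atTop 0)).exists
  obtain ⟨t, ht, hGt⟩ := intermediate_value_Icc hT0 hcont.continuousOn
    (show gTail p 0 / 2 ∈ Icc (G 0) (G T) from ⟨by simpa [hG] using (half_pos hpos).le, hT.le⟩)
  have heq : gTail p t = gTail p 0 / 2 := by rw [hGg t ht.1, hGt]; ring
  refine ⟨t, ⟨ht.1, heq⟩, ?_⟩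
  rintro s ⟨hs, hs'⟩
  rcases lt_trichotomy s t with h | h | h
  · have := hanti s t hs h; linarith
  · exact h
  · have := hanti t s ht.1 h; linarith

/-- `zStar p` has its defining property. -/
theorem zStar_spec {p : ℝ} (hp : 0 < p) :
    0 ≤ zStar p ∧ gTail p (zStar p) = gTail p 0 / 2 := by
  obtain ⟨t, ht, hu⟩ := existsUnique_split hp
  have : {t : ℝ | 0 ≤ t ∧ gTail p t = gTail p 0 / 2} = {t} :=
    Set.eq_singleton_iff_unique_mem.2 ⟨ht, fun s hs => hu s hs⟩
  rw [zStar, this, csInf_singleton]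
  exact ht

/-!
The idea is to reduce recovery to a law of large numbers that holds uniformly over the sphere.

By the null-space criterion (`recoversAll_of_forall_sum_lt`), `A` recovers every signal as soon as,
for each unit vector `z` and each set `T` of at most `ρ m` coordinates,
`∑_T |(A z) i| ^ p < ∑_{Tᶜ} |(A z) i| ^ p`. The supremum over `T` is removed by duality. With
`s = zStar p ^ p` and the reflected power `truncPow p s x = min (|x| ^ p) (2 s - |x| ^ p)`,
`∑_{Tᶜ} |v i| ^ p - ∑_T |v i| ^ p ≥ ∑ i, truncPow p s (v i) - 2 s |T|`,
so it is enough that `∑ i, truncPow p s ((A z) i)` exceeds `2 s ρ m`. For a unit vector `z` the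
coordinates of `A z` are independent standard Gaussians (`IsStdGaussianMatrix.mulVec`), and the
defining property of `zStar p` gives each summand the mean `2 s * rhoStar p`
(`integral_truncPow`), which is larger than `2 s ρ`.

For a single `z` the exponential lower-tail bound `exists_measure_sum_le_exp` makes failure
exponentially unlikely in `m`; applied to `-|x| ^ p` it also bounds `lpPow p (A z)` by a multiple
of `m`. Both bounds hold on a `δ`-net of the sphere, of size at most `(1 + 2 / δ) ^ n`
(`exists_finset_net_sphere`), once `m` is a large multiple of `n`. Since `truncPow` changes by at
most `|a - b| ^ p` and `lpPow p` is subadditive for `p ≤ 1`, they pass from the net to the whole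
sphere (`lpPow_mulVec_le_of_net`, `recoversAll_of_net`).
-/

/-! ### Linear images of a standard Gaussian matrix -/

/-- A linear combination of independent standard Gaussians is a centred Gaussian whose variance is
the sum of the squared coefficients. -/
lemma hasLaw_sum_mul_gaussian {Ω ι : Type*} [MeasurableSpace Ω] {P : Measure Ω}
    {X : ι → Ω → ℝ} (hX : ∀ j, HasLaw (X j) (gaussianReal 0 1) P) (hind : iIndepFun X P)
    (z : ι → ℝ) (s : Finset ι) :
    HasLaw (∑ j ∈ s, fun ω => X j ω * z j)
      (gaussianReal 0 (∑ j ∈ s, NNReal.mk (z j ^ 2) (sq_nonneg _))) P := by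
  classical
  have := hind.isProbabilityMeasure
  have hm : ∀ j, AEMeasurable (fun ω => X j ω * z j) P :=
    fun j => (hX j).aemeasurable.mul_const _
  have hind' : iIndepFun (fun j ω => X j ω * z j) P :=
    hind.comp₀ (fun j x => x * z j) (fun j => (hX j).aemeasurable) (fun j => by fun_prop)
  induction s using Finset.induction_on with
  | empty =>
    refine ⟨aemeasurable_const, ?_⟩
    simp only [Finset.sum_empty, gaussianReal_zero_var]
    exact (Measure.map_const P (0 : ℝ)).trans (by simp)
  | insert j s hj ih =>
    rw [Finset.sum_insert hj, Finset.sum_insert hj]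
    refine ⟨(hm j).add ih.aemeasurable, ?_⟩
    have h1 : P.map (fun ω => X j ω * z j) = gaussianReal 0 (NNReal.mk (z j ^ 2) (sq_nonneg _)) := by
      have := (gaussianReal_const_mul (hX j) (z j)).map_eq
      simp only [mul_one, mul_comm (z j), zero_mul] at this
      exact this
    have := gaussianReal_add_gaussianReal_of_indepFun
      (hind'.indepFun_finsetSum_of_notMem₀ hm hj).symm h1 ih.map_eq
    simpa using this

/-- The rows of a matrix with independent entries are independent. -/
lemma IsStdGaussianMatrix.iIndepFun_row {Ω : Type*} [MeasurableSpace Ω] {P : Measure Ω}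
    {m n : ℕ} {A : Ω → Matrix (Fin m) (Fin n) ℝ} (hA : IsStdGaussianMatrix P A) :
    iIndepFun (fun (i : Fin m) ω => A ω i) P := by
  have := hA.indep.isProbabilityMeasure
  have hm : ∀ i j, AEMeasurable (fun ω => A ω i j) P := fun i j => (hA.hasLaw i j).aemeasurable
  have hrow : ∀ i, AEMeasurable (fun ω => A ω i) P := fun i => aemeasurable_pi_lambda _ (hm i)
  have hmat : AEMeasurable (fun ω i => A ω i) P := aemeasurable_pi_lambda _ hrow
  have hent : AEMeasurable (fun ω (ij : Fin m × Fin n) => A ω ij.1 ij.2) P :=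
    aemeasurable_pi_lambda _ fun ij => hm ij.1 ij.2
  rw [iIndepFun_iff_map_fun_eq_infinitePi_map₀ hmat]
  have h1 := (iIndepFun_iff_map_fun_eq_infinitePi_map₀ hent).1 hA.indep
  have h2 : ∀ i, P.map (fun ω => A ω i) =
      Measure.infinitePi fun _ : Fin n => gaussianReal 0 1 := fun i => by
    have := hA.indep.precomp (g := fun j : Fin n => (i, j)) (fun a b h => by simpa using h)
    have := (iIndepFun_iff_map_fun_eq_infinitePi_map₀ (hrow i)).1 this
    simpa only [(hA.hasLaw _ _).map_eq] using this
  simp only [(hA.hasLaw _ _).map_eq] at h1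
  simp only [h2]
  rw [← Measure.infinitePi_map_curry (fun (_ : Fin m) (_ : Fin n) => gaussianReal 0 1), ← h1,
    AEMeasurable.map_map_of_aemeasurable (by fun_prop) hent]
  rfl

/-- For a unit vector `z`, the coordinates of `A z` are independent standard Gaussians. -/
lemma IsStdGaussianMatrix.mulVec {Ω : Type*} [MeasurableSpace Ω] {P : Measure Ω}
    {m n : ℕ} {A : Ω → Matrix (Fin m) (Fin n) ℝ} (hA : IsStdGaussianMatrix P A)
    {z : EuclideanSpace ℝ (Fin n)} (hz : ‖z‖ = 1) :
    (∀ i, HasLaw (fun ω => (A ω).mulVec z i) (gaussianReal 0 1) P) ∧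
      iIndepFun (fun i ω => (A ω).mulVec z i) P := by
  have hrow : ∀ i, AEMeasurable (fun ω => A ω i) P :=
    fun i => aemeasurable_pi_lambda _ fun j => (hA.hasLaw i j).aemeasurable
  refine ⟨fun i => ?_, ?_⟩
  · have := hasLaw_sum_mul_gaussian (fun j => hA.hasLaw i j)
      (hA.indep.precomp (g := fun j : Fin n => (i, j)) (fun a b h => by simpa using h))
      z Finset.univ
    convert! this using 1
    · ext ω; simp [Matrix.mulVec, dotProduct]
    · congr 1
      apply NNReal.coe_injective
      rw [NNReal.coe_sum]
      simpa [hz] using EuclideanSpace.norm_sq_eq z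
  · exact hA.iIndepFun_row.comp₀ (fun _ r => ∑ j, r j * z j) hrow
      (fun i => Measurable.aemeasurable (by fun_prop))

/-! ### An exponential lower-tail bound -/

/-- Cramér-type bound: if `g` has exponential moments near zero under `ν` and `b < ∫ g dν`, the
event `∑ g(X i) ≤ b m` has exponentially small probability for `m` independent samples of `ν`, at
a rate depending only on `ν`, `g`, `b`. -/
theorem exists_measure_sum_le_exp {ν : Measure ℝ} [IsProbabilityMeasure ν] {g : ℝ → ℝ}
    (hg : Measurable g) (hexp : 0 ∈ interior (integrableExpSet g ν)) {b : ℝ}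
    (hb : b < ∫ x, g x ∂ν) :
    ∃ c : ℝ, 0 < c ∧ ∀ (m : ℕ) (Ω : Type*) [MeasurableSpace Ω] (P : Measure Ω)
      (X : Fin m → Ω → ℝ), (∀ i, HasLaw (X i) ν P) → iIndepFun X P →
        P.real {ω | ∑ i, g (X i ω) ≤ b * m} ≤ Real.exp (-c * m) := by
  -- `t ↦ exp (-t b) * mgf g ν t` is `1` at zero with positive derivative: it is below `1` slightly
  -- to the left of zero.
  have hder : HasDerivAt (fun t => Real.exp (-t * b) * mgf g ν t) (∫ x, g x ∂ν - b) 0 := by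
    have h1 : HasDerivAt (mgf g ν) (∫ x, g x ∂ν) 0 := by
      simpa using hasDerivAt_mgf hexp
    have h2 : HasDerivAt (fun t : ℝ => Real.exp (-t * b)) (-b) 0 := by
      simpa using (((hasDerivAt_id (0 : ℝ)).neg.mul_const b).exp)
    convert! h2.mul h1 using 1
    simp; ring
  have hslope : ∀ᶠ t in 𝓝[<] (0 : ℝ), Real.exp (-t * b) * mgf g ν t < 1 := by
    have h := (hasDerivAt_iff_tendsto_slope_left_right.1 hder).1.eventually
      (lt_mem_nhds (sub_pos.2 hb))
    filter_upwards [h, self_mem_nhdsWithin] with t ht ht0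
    rw [slope_def_field] at ht
    have ht0 : t < 0 := ht0
    have := (div_pos_iff.1 ht).resolve_left fun h => by linarith [h.2]
    simpa using this.1
  obtain ⟨t, ht1, hts, ht0⟩ := (hslope.and ((eventually_mem_set.2
    (nhdsWithin_le_nhds (mem_interior_iff_mem_nhds.1 hexp))).and self_mem_nhdsWithin)).exists
  have ht0 : t < 0 := ht0
  have hint : Integrable (fun x => Real.exp (t * g x)) ν := hts
  have hmgf : 0 < mgf g ν t := mgf_pos hint
  have hφ : 0 < Real.exp (-t * b) * mgf g ν t := by positivity
  refine ⟨-Real.log (Real.exp (-t * b) * mgf g ν t), neg_pos.2 (Real.log_neg hφ ht1), ?_⟩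
  intro m Ω _ P X hX hind
  have := hind.isProbabilityMeasure
  have hgX : ∀ i, AEMeasurable (g ∘ X i) P := fun i => hg.comp_aemeasurable (hX i).aemeasurable
  have hind' : iIndepFun (fun i => g ∘ X i) P :=
    hind.comp₀ (fun _ => g) (fun i => (hX i).aemeasurable) (fun i => hg.aemeasurable)
  have hsum : mgf (∑ i, g ∘ X i) P t = mgf g ν t ^ m := by
    rw [hind'.mgf_sum₀ hgX, Finset.prod_eq_pow_card (b := mgf g ν t)]
    · simp
    · intro i _
      rw [← (hX i).map_eq, mgf_map (hX i).aemeasurable]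
      exact Measurable.aestronglyMeasurable (by fun_prop)
  -- a nonzero Bochner integral has an integrable integrand
  have hintS : Integrable (fun ω => Real.exp (t * (∑ i, g ∘ X i) ω)) P := by
    by_contra h
    exact (pow_pos hmgf m).ne' (hsum.symm.trans (integral_undef h))
  have := measure_le_le_exp_mul_mgf (b * m) ht0.le hintS
  rw [hsum] at this
  calc P.real {ω | ∑ i, g (X i ω) ≤ b * m} = P.real {ω | (∑ i, g ∘ X i) ω ≤ b * m} := by simp
    _ ≤ _ := this
    _ = (Real.exp (-t * b) * mgf g ν t) ^ m := by
      rw [mul_pow, ← Real.exp_nat_mul]; ring_nf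
    _ = _ := by
      rw [neg_neg, mul_comm (Real.log _), Real.exp_nat_mul, Real.exp_log hφ]

/-- A function of at most linear growth has all exponential moments under the Gaussian. -/
lemma integrableExpSet_gaussianReal_of_abs_le {g : ℝ → ℝ} (hg : Measurable g) {C : ℝ}
    (hgC : ∀ x, |g x| ≤ C + |x|) : integrableExpSet g (gaussianReal 0 1) = univ := by
  refine eq_univ_of_forall fun t => ?_
  have h : Integrable (fun x : ℝ => Real.exp (|t| * |x|)) (gaussianReal 0 1) :=
    integrable_exp_abs_mul_abs (integrable_exp_mul_gaussianReal t)
      (integrable_exp_mul_gaussianReal (-t))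
  refine (h.const_mul (Real.exp (|t| * C))).mono'
    (Measurable.aestronglyMeasurable (by fun_prop)) (ae_of_all _ fun x => ?_)
  rw [Real.norm_eq_abs, Real.abs_exp, ← Real.exp_add, ← mul_add]
  refine Real.exp_le_exp.2 ((le_abs_self _).trans ?_)
  rw [abs_mul]
  exact mul_le_mul_of_nonneg_left (hgC x) (abs_nonneg t)

/-! ### Nets of the sphere -/

/-- Volume bound: a `δ`-separated set in the unit ball has at most `(1 + 2 / δ) ^ dim` elements. -/
lemma card_le_of_separated_sphere {E : Type*} [NormedAddCommGroup E] [NormedSpace ℝ E]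
    [FiniteDimensional ℝ E] {δ : ℝ} (hδ : 0 < δ) (s : Finset E) (hs : ∀ c ∈ s, ‖c‖ ≤ 1)
    (h : ∀ c ∈ s, ∀ d ∈ s, c ≠ d → δ ≤ ‖c - d‖) :
    (s.card : ℝ) ≤ (1 + 2 / δ) ^ Module.finrank ℝ E := by
  borelize E
  let μ : Measure E := Measure.addHaar
  have hr : 0 < δ / 2 := by positivity
  have hR : 0 < 1 + δ / 2 := by positivity
  have D : (s : Set E).Pairwise (Function.onFun Disjoint fun c => Metric.ball c (δ / 2)) := by
    intro c hc d hd hcd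
    apply Metric.ball_disjoint_ball
    rw [dist_eq_norm, add_halves]
    exact h c hc d hd hcd
  have hsub : (⋃ c ∈ s, Metric.ball c (δ / 2)) ⊆ Metric.ball (0 : E) (1 + δ / 2) := by
    refine iUnion₂_subset fun x hx => Metric.ball_subset_ball' ?_
    rw [dist_zero_right, add_comm]
    exact add_le_add_left (hs x hx) _
  have hvol := measure_mono (μ := μ) hsub
  rw [measure_biUnion_finset D fun c _ => measurableSet_ball] at hvol
  simp only [μ.addHaar_ball_of_pos _ hr, μ.addHaar_ball_of_pos _ hR, Finset.sum_const,
    nsmul_eq_mul, ← mul_assoc] at hvol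
  rw [ENNReal.mul_le_mul_iff_left (Metric.measure_ball_pos _ _ zero_lt_one).ne'
    measure_ball_lt_top.ne] at hvol
  have hreal := ENNReal.toReal_le_of_le_ofReal (by positivity) hvol
  rw [ENNReal.toReal_mul, ENNReal.toReal_ofReal (by positivity), ENNReal.toReal_natCast,
    ← le_div_iff₀ (by positivity), ← div_pow] at hreal
  refine hreal.trans_eq ?_
  congr 1
  field_simp
  ring

/-- The unit sphere of a finite-dimensional space has a `δ`-net of cardinality at most
`(1 + 2 / δ) ^ dim`. -/
theorem exists_finset_net_sphere (E : Type*) [NormedAddCommGroup E] [NormedSpace ℝ E]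
    [FiniteDimensional ℝ E] {δ : ℝ} (hδ : 0 < δ) :
    ∃ s : Finset E, (∀ c ∈ s, ‖c‖ = 1) ∧ (s.card : ℝ) ≤ (1 + 2 / δ) ^ Module.finrank ℝ E ∧
      ∀ z : E, ‖z‖ = 1 → ∃ c ∈ s, ‖z - c‖ ≤ δ := by
  lift δ to NNReal using hδ.le
  obtain ⟨s, hsub, hcov⟩ : ∃ s : Set E, s ⊆ Metric.sphere 0 1 ∧
      Metric.IsSeparated δ s ∧ Metric.IsCover δ (Metric.sphere (0 : E) 1) s := by
    obtain ⟨s, hs⟩ := zorn_subset {N : Set E | N ⊆ Metric.sphere 0 1 ∧ Metric.IsSeparated δ N} (by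
      intro c hc hchain
      refine ⟨⋃₀ c, ⟨sUnion_subset fun t ht => (hc ht).1, ?_⟩, fun t => subset_sUnion_of_mem⟩
      exact (pairwise_sUnion hchain.directedOn).2 fun t ht => (hc ht).2)
    exact ⟨s, hs.prop.1, hs.prop.2, .of_maximal_isSeparated hs⟩
  have hcard : ∀ t : Finset E, (t : Set E) ⊆ s →
      (t.card : ℝ) ≤ (1 + 2 / δ) ^ Module.finrank ℝ E := fun t ht =>
    card_le_of_separated_sphere hδ t (fun c hc => by simpa using (hsub (ht hc)).le)
      fun c hc d hd hcd => by
        have : (δ : ENNReal) < edist c d := hcov.1 (ht hc) (ht hd) hcd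
        rw [edist_dist, dist_eq_norm, ← ENNReal.ofReal_coe_nnreal] at this
        exact (ENNReal.ofReal_lt_ofReal_iff_of_nonneg δ.2).1 this |>.le
  have hfin : s.Finite := by
    by_contra hinf
    obtain ⟨k, hk⟩ := exists_nat_gt ((1 + 2 / (δ : ℝ)) ^ Module.finrank ℝ E)
    obtain ⟨t, ht, htk⟩ := Set.Infinite.exists_subset_card_eq hinf k
    exact absurd (hcard t ht) (by rw [htk]; exact not_le.2 hk)
  refine ⟨hfin.toFinset, fun c hc => ?_, hcard _ (by simp), fun z hz => ?_⟩
  · simpa using hsub (hfin.mem_toFinset.1 hc)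
  · have := (Metric.isCover_iff_subset_iUnion_closedBall.1 hcov.2)
      (mem_sphere_zero_iff_norm.2 hz)
    simpa [dist_eq_norm] using this

/-! ### The truncated power -/

/-- `truncPow p s x = min (|x| ^ p) (2 s - |x| ^ p)`: the power `|x| ^ p`, reflected at height `s`.
It bounds from below the contribution of a coordinate `x` to `∑_{Tᶜ} |x i| ^ p - ∑_T |x i| ^ p`, up
to a cost of `2 s` for each element of `T`. -/
noncomputable def truncPow (p s x : ℝ) : ℝ := min (|x| ^ p) (2 * s - |x| ^ p)

lemma measurable_truncPow (p s : ℝ) : Measurable (truncPow p s) := by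
  unfold truncPow; fun_prop

lemma abs_add_rpow_le {p : ℝ} (hp0 : 0 < p) (hp1 : p ≤ 1) (a b : ℝ) :
    |a + b| ^ p ≤ |a| ^ p + |b| ^ p :=
  (Real.rpow_le_rpow (abs_nonneg _) (abs_add_le a b) hp0.le).trans
    (Real.rpow_add_le_add_rpow (abs_nonneg a) (abs_nonneg b) hp0.le hp1)

lemma truncPow_sub_le {p : ℝ} (hp0 : 0 < p) (hp1 : p ≤ 1) (s a b : ℝ) :
    truncPow p s b - |a - b| ^ p ≤ truncPow p s a := by
  have h1 := abs_add_rpow_le hp0 hp1 (a - b) b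
  have h2 := abs_add_rpow_le hp0 hp1 (b - a) a
  rw [sub_add_cancel] at h1 h2
  rw [abs_sub_comm] at h2
  unfold truncPow
  rcases min_cases (|b| ^ p) (2 * s - |b| ^ p) with h | h <;>
  rcases min_cases (|a| ^ p) (2 * s - |a| ^ p) with h' | h' <;> linarith

lemma rpow_abs_le_one_add_abs {p : ℝ} (hp0 : 0 < p) (hp1 : p ≤ 1) (x : ℝ) :
    |x| ^ p ≤ 1 + |x| := by
  rcases le_total (|x|) 1 with h | h
  · linarith [Real.rpow_le_one (abs_nonneg x) h hp0.le, abs_nonneg x]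
  · have := Real.rpow_le_rpow_of_exponent_le h hp1
    rw [Real.rpow_one] at this
    linarith

lemma abs_truncPow_le {p : ℝ} (hp0 : 0 < p) (hp1 : p ≤ 1) {s : ℝ} (hs : 0 ≤ s) (x : ℝ) :
    |truncPow p s x| ≤ (1 + 2 * s) + |x| := by
  have h1 := rpow_abs_le_one_add_abs hp0 hp1 x
  have h2 := Real.rpow_nonneg (abs_nonneg x) p
  unfold truncPow
  rw [abs_le]
  rcases min_cases (|x| ^ p) (2 * s - |x| ^ p) with h | h <;> constructor <;> linarith

lemma zStar_pos {p : ℝ} (hp : 0 < p) : 0 < zStar p := by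
  obtain ⟨h0, h1⟩ := zStar_spec hp
  refine h0.lt_of_ne fun h => ?_
  rw [← h] at h1
  have hpos : 0 < gTail p 0 := by
    rw [gTail, setIntegral_pos_iff_support_of_nonneg_ae]
    · refine (absGaussian_Ioo_pos le_rfl one_pos).trans_le (measure_mono fun x hx => ⟨?_, hx.1⟩)
      exact (Real.rpow_pos_of_pos hx.1 p).ne'
    · filter_upwards [ae_restrict_mem measurableSet_Ioi] with x hx
      exact Real.rpow_nonneg (le_of_lt hx) p
    · exact (integrable_rpow_absGaussian hp).integrableOn
  linarith

/-- This is where the threshold comes from: reflecting `|x| ^ p` at `zStar p ^ p` removes twice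
`E[|X| ^ p ; |X| > zStar p]`, which is all of `E |X| ^ p`, and gives back `2 zStar p ^ p` on an
event of probability `rhoStar p`. -/
theorem integral_truncPow {p : ℝ} (hp : 0 < p) :
    ∫ x, truncPow p (zStar p ^ p) x ∂gaussianReal 0 1 = 2 * zStar p ^ p * rhoStar p := by
  obtain ⟨h0, h1⟩ := zStar_spec hp
  set t := zStar p
  have hint := integrable_rpow_absGaussian hp
  have hnn : ∀ᵐ z ∂absGaussian, 0 ≤ z := by
    rw [absGaussian, ae_map_iff (by fun_prop) measurableSet_Ici]
    exact ae_of_all _ abs_nonneg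
  have hI : IntegrableOn (fun z : ℝ => z ^ p - t ^ p) (Ioi t) absGaussian :=
    (hint.sub (integrable_const _)).integrableOn
  have hfull : ∫ z, z ^ p ∂absGaussian = gTail p 0 := by
    rw [gTail, setIntegral_eq_integral_of_ae_compl_eq_zero]
    filter_upwards [hnn] with z hz hz0
    rw [le_antisymm (not_lt.1 hz0) hz, Real.zero_rpow hp.ne']
  have hcdf : rhoStar p = absGaussian.real (Ioi t) := by
    rw [rhoStar, cdf_eq_real, ← probReal_compl_eq_one_sub measurableSet_Iic, compl_Iic]
  calc ∫ x, truncPow p (t ^ p) x ∂gaussianReal 0 1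
      = ∫ z, min (z ^ p) (2 * t ^ p - z ^ p) ∂absGaussian := by
        rw [absGaussian, integral_map (by fun_prop)
          (Measurable.aestronglyMeasurable (by fun_prop))]
        rfl
    _ = ∫ z, (z ^ p - 2 * (Ioi t).indicator (fun z => z ^ p - t ^ p) z) ∂absGaussian := by
        refine integral_congr_ae ?_
        filter_upwards [hnn] with z hz
        rcases le_or_gt z t with h | h
        · have := Real.rpow_le_rpow hz h hp.le
          rw [indicator_of_notMem (by simpa using h), min_eq_left (by linarith)]
          ring
        · have := Real.rpow_le_rpow h0 h.le hp.le
          rw [indicator_of_mem (by simpa using h), min_eq_right (by linarith)]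
          ring
    _ = 2 * t ^ p * rhoStar p := by
        rw [integral_sub hint ((hI.integrable_indicator measurableSet_Ioi).const_mul 2),
          integral_const_mul, integral_indicator measurableSet_Ioi,
          integral_sub hint.integrableOn (integrable_const _), hfull, setIntegral_const, hcdf]
        change _ - 2 * (gTail p t - _) = _
        rw [h1, smul_eq_mul]
        ring

/-! ### Deterministic conditions for recovery -/

lemma lpPow_add_le {m : ℕ} {p : ℝ} (hp0 : 0 < p) (hp1 : p ≤ 1) (u v : Fin m → ℝ) :
    lpPow p (u + v) ≤ lpPow p u + lpPow p v := by
  simp only [lpPow, ← Finset.sum_add_distrib]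
  exact Finset.sum_le_sum fun i _ => abs_add_rpow_le hp0 hp1 _ _

lemma lpPow_smul {m : ℕ} (p c : ℝ) (v : Fin m → ℝ) :
    lpPow p (c • v) = |c| ^ p * lpPow p v := by
  simp only [lpPow, Finset.mul_sum, Pi.smul_apply, smul_eq_mul, abs_mul]
  exact Finset.sum_congr rfl fun i _ => Real.mul_rpow (abs_nonneg _) (abs_nonneg _)

/-- Null-space criterion: recovery holds if, for every unit vector `z`, the coordinates of `A z` on
any small set carry less than half of its `l_p` mass. -/
theorem recoversAll_of_forall_sum_lt {m n : ℕ} {p ρ : ℝ} (hp0 : 0 < p) (hp1 : p ≤ 1)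
    {A : Matrix (Fin m) (Fin n) ℝ}
    (h : ∀ z : EuclideanSpace ℝ (Fin n), ‖z‖ = 1 → ∀ T : Finset (Fin m), (T.card : ℝ) ≤ ρ * m →
      ∑ i ∈ T, |A.mulVec z i| ^ p < ∑ i ∈ Tᶜ, |A.mulVec z i| ^ p) :
    RecoversAll p ρ A := by
  classical
  intro f e he x hx
  set T : Finset (Fin m) := {i | e i ≠ 0} with hT
  have hcard : (T.card : ℝ) ≤ ρ * m := by
    rwa [← Set.ncard_coe_finset, hT, Finset.coe_filter_univ]
  set w : EuclideanSpace ℝ (Fin n) := WithLp.toLp 2 (x - f) with hw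
  have hw0 : w ≠ 0 := fun h0 => hx (sub_eq_zero.1 (congrArg WithLp.ofLp h0))
  have hnorm : 0 < ‖w‖ := norm_pos_iff.2 hw0
  have hlt : ∑ i ∈ T, |A.mulVec w i| ^ p < ∑ i ∈ Tᶜ, |A.mulVec w i| ^ p := by
    have := h (‖w‖⁻¹ • w) (by rw [norm_smul, norm_inv, norm_norm, inv_mul_cancel₀ hnorm.ne']) T hcard
    simp only [WithLp.ofLp_smul, Matrix.mulVec_smul, Pi.smul_apply, smul_eq_mul, abs_mul,
      Real.mul_rpow (abs_nonneg _) (abs_nonneg _), ← Finset.mul_sum] at this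
    exact lt_of_mul_lt_mul_left this (by positivity)
  have h1 : A.mulVec f + e - A.mulVec f = e := by simp
  have h2 : A.mulVec f + e - A.mulVec x = e - A.mulVec w := by
    rw [hw, Matrix.mulVec_sub]; abel
  rw [h1, h2]
  simp only [lpPow, ← Finset.sum_add_sum_compl T]
  have hz : ∀ i ∈ Tᶜ, e i = 0 := fun i hi => by simpa [hT] using hi
  have h3 : ∑ i ∈ Tᶜ, |e i| ^ p = 0 :=
    Finset.sum_eq_zero fun i hi => by rw [hz i hi, abs_zero, Real.zero_rpow hp0.ne']
  have h4 : ∑ i ∈ Tᶜ, |(e - A.mulVec w) i| ^ p = ∑ i ∈ Tᶜ, |A.mulVec w i| ^ p :=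
    Finset.sum_congr rfl fun i hi => by simp [hz i hi]
  have h5 : ∑ i ∈ T, |e i| ^ p ≤
      ∑ i ∈ T, |(e - A.mulVec w) i| ^ p + ∑ i ∈ T, |A.mulVec w i| ^ p := by
    rw [← Finset.sum_add_distrib]
    refine Finset.sum_le_sum fun i _ => ?_
    have := abs_add_rpow_le hp0 hp1 (e i - A.mulVec w i) (A.mulVec w i)
    rwa [sub_add_cancel] at this
  linarith

lemma sum_lt_sum_compl_of_sum_truncPow {m : ℕ} {p ρ s : ℝ} (hs : 0 ≤ s) {v : Fin m → ℝ}
    (hv : 2 * s * (ρ * m) < ∑ i, truncPow p s (v i)) {T : Finset (Fin m)}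
    (hT : (T.card : ℝ) ≤ ρ * m) : ∑ i ∈ T, |v i| ^ p < ∑ i ∈ Tᶜ, |v i| ^ p := by
  rw [← Finset.sum_add_sum_compl T] at hv
  have h1 : ∑ i ∈ T, truncPow p s (v i) ≤ 2 * s * T.card - ∑ i ∈ T, |v i| ^ p := by
    calc _ ≤ ∑ i ∈ T, (2 * s - |v i| ^ p) := Finset.sum_le_sum fun i _ => min_le_right _ _
      _ = _ := by rw [Finset.sum_sub_distrib, Finset.sum_const, nsmul_eq_mul, mul_comm]
  have h2 : ∑ i ∈ Tᶜ, truncPow p s (v i) ≤ ∑ i ∈ Tᶜ, |v i| ^ p :=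
    Finset.sum_le_sum fun i _ => min_le_left _ _
  have h3 := mul_le_mul_of_nonneg_left hT (by positivity : 0 ≤ 2 * s)
  linarith

/-- A bound for `‖A w‖_p^p` on a `δ`-net extends to the whole sphere, at the cost of a factor
`1 / (1 - δ ^ p)`: compare the maximum over the sphere with its value at the nearest net point. -/
lemma lpPow_mulVec_le_of_net {m n : ℕ} {p δ M : ℝ} (hp0 : 0 < p) (hp1 : p ≤ 1)
    (hδp : δ ^ p < 1) {A : Matrix (Fin m) (Fin n) ℝ}
    {N : Finset (EuclideanSpace ℝ (Fin n))}
    (hnet : ∀ z : EuclideanSpace ℝ (Fin n), ‖z‖ = 1 → ∃ c ∈ N, ‖z - c‖ ≤ δ)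
    (hM : ∀ c ∈ N, lpPow p (A.mulVec c) ≤ M) (u : EuclideanSpace ℝ (Fin n)) :
    lpPow p (A.mulVec u) ≤ ‖u‖ ^ p * (M / (1 - δ ^ p)) := by
  have hscale : ∀ (K : ℝ), (∀ z : EuclideanSpace ℝ (Fin n), ‖z‖ = 1 → lpPow p (A.mulVec z) ≤ K) →
      ∀ u : EuclideanSpace ℝ (Fin n), lpPow p (A.mulVec u) ≤ ‖u‖ ^ p * K := by
    intro K hK u
    rcases eq_or_ne u 0 with rfl | hu
    · simp [lpPow, Real.zero_rpow hp0.ne']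
    · have hnorm : 0 < ‖u‖ := norm_pos_iff.2 hu
      have hunit : ‖‖u‖⁻¹ • u‖ = 1 := by
        rw [norm_smul, norm_inv, norm_norm, inv_mul_cancel₀ hnorm.ne']
      have hu' : A.mulVec u = ‖u‖ • A.mulVec (‖u‖⁻¹ • u : EuclideanSpace ℝ (Fin n)) := by
        rw [WithLp.ofLp_smul, Matrix.mulVec_smul, smul_smul, mul_inv_cancel₀ hnorm.ne', one_smul]
      rw [hu', lpPow_smul, abs_norm]
      exact mul_le_mul_of_nonneg_left (hK _ hunit) (by positivity)
  refine hscale _ (fun z hz => ?_) u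
  have hcont : Continuous fun w : EuclideanSpace ℝ (Fin n) => lpPow p (A.mulVec w) := by
    unfold lpPow
    refine continuous_finsetSum _ fun i _ => Continuous.rpow_const ?_ fun _ => Or.inr hp0.le
    simp only [Matrix.mulVec, dotProduct]
    fun_prop
  obtain ⟨w, hw, hmax⟩ := (isCompact_sphere (0 : EuclideanSpace ℝ (Fin n)) 1).exists_isMaxOn
    ⟨z, by simpa using hz⟩ hcont.continuousOn
  have hwz : lpPow p (A.mulVec z) ≤ lpPow p (A.mulVec w) :=
    isMaxOn_iff.1 hmax z (by simpa using hz)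
  obtain ⟨c, hc, hwc⟩ := hnet w (by simpa using hw)
  have h1 := lpPow_add_le hp0 hp1 (A.mulVec (w - c : EuclideanSpace ℝ (Fin n))) (A.mulVec c)
  rw [WithLp.ofLp_sub, Matrix.mulVec_sub, sub_add_cancel, ← Matrix.mulVec_sub,
    ← WithLp.ofLp_sub] at h1
  have h2 := hscale _ (fun z' hz' => isMaxOn_iff.1 hmax z' (by simpa using hz')) (w - c)
  have hW : 0 ≤ lpPow p (A.mulVec w) :=
    Finset.sum_nonneg fun i _ => Real.rpow_nonneg (abs_nonneg _) _
  have h3 := mul_le_mul_of_nonneg_right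
    (Real.rpow_le_rpow (norm_nonneg _) hwc hp0.le) hW
  have h4 := hM c hc
  refine hwz.trans ?_
  rw [le_div_iff₀ (by linarith)]
  linarith

/-- The conditions on a net that, for a Gaussian matrix, fail only with exponentially small
probability already force recovery. -/
theorem recoversAll_of_net {m n : ℕ} {p ρ s b B δ : ℝ} (hp0 : 0 < p) (hp1 : p ≤ 1) (hs : 0 ≤ s)
    (hm : 0 < m) (hδp : δ ^ p < 1) (hb : 2 * s * ρ + δ ^ p * (B / (1 - δ ^ p)) < b)
    (hB : 0 ≤ B) {A : Matrix (Fin m) (Fin n) ℝ} {N : Finset (EuclideanSpace ℝ (Fin n))}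
    (hnet : ∀ z : EuclideanSpace ℝ (Fin n), ‖z‖ = 1 → ∃ c ∈ N, ‖z - c‖ ≤ δ)
    (hlow : ∀ c ∈ N, b * m ≤ ∑ i, truncPow p s (A.mulVec c i))
    (hup : ∀ c ∈ N, lpPow p (A.mulVec c) ≤ B * m) : RecoversAll p ρ A := by
  refine recoversAll_of_forall_sum_lt hp0 hp1 fun z hz T hT =>
    sum_lt_sum_compl_of_sum_truncPow hs ?_ hT
  obtain ⟨c, hc, hzc⟩ := hnet z hz
  have h1 := lpPow_mulVec_le_of_net hp0 hp1 hδp hnet hup (z - c)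
  have h2 : ∑ i, truncPow p s (A.mulVec c i) - lpPow p (A.mulVec (z - c : EuclideanSpace ℝ (Fin n)))
      ≤ ∑ i, truncPow p s (A.mulVec z i) := by
    rw [lpPow, ← Finset.sum_sub_distrib]
    refine Finset.sum_le_sum fun i _ => ?_
    rw [WithLp.ofLp_sub, Matrix.mulVec_sub]
    exact truncPow_sub_le hp0 hp1 s _ _
  have h3 : ‖z - c‖ ^ p * (B * m / (1 - δ ^ p)) ≤ δ ^ p * (B * m / (1 - δ ^ p)) :=
    mul_le_mul_of_nonneg_right (Real.rpow_le_rpow (norm_nonneg _) hzc hp0.le)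
      (div_nonneg (by positivity) (by linarith))
  have h4 := hlow c hc
  have hm' : (0 : ℝ) < m := by exact_mod_cast hm
  have h5 := mul_lt_mul_of_pos_right hb hm'
  have h6 : δ ^ p * (B * m / (1 - δ ^ p)) = δ ^ p * (B / (1 - δ ^ p)) * m := by ring
  linarith

/-! ### The union bound over the net -/

theorem mainTheorem1 (p : ℝ) (hp0 : 0 < p) (hp1 : p ≤ 1) (ρ : ℝ) (hρ : ρ < rhoStar p) :
    ∃ c₄ c₅ : ℝ, 0 < c₄ ∧ 0 < c₅ ∧ ∃ N : ℕ, ∀ n m : ℕ, N ≤ n → c₄ * n ≤ m →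
      ∀ (Ω : Type*) [MeasurableSpace Ω] (P : Measure Ω) [IsProbabilityMeasure P]
        (A : Ω → Matrix (Fin m) (Fin n) ℝ), IsStdGaussianMatrix P A →
        ∃ E : Set Ω, MeasurableSet E ∧ 1 - Real.exp (-c₅ * n) ≤ P.real E ∧
          ∀ ω ∈ E, RecoversAll p ρ (A ω) := by
  set s := zStar p ^ p with hs
  have hs0 : 0 < s := Real.rpow_pos_of_pos (zStar_pos hp0) p
  -- `b` is the midpoint of the required value `2 s ρ` and the mean `2 s rhoStar p`; a gap of
  -- `ε` remains on either side.
  set b := s * (ρ + rhoStar p) with hb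
  set ε := s * (rhoStar p - ρ) with hε
  have hε0 : 0 < ε := mul_pos hs0 (sub_pos.2 hρ)
  set B := ∫ x, |x| ^ p ∂gaussianReal 0 1 + 1 with hB
  have hB0 : 0 < B := by
    have : 0 ≤ ∫ x, |x| ^ p ∂gaussianReal 0 1 :=
      integral_nonneg fun x => Real.rpow_nonneg (abs_nonneg _) _
    linarith
  -- `η = δ ^ p` is at most `1 / 2`, so that the net error `η B / (1 - η)` is at most `2 η B < ε`
  set η := min (1 / 2) (ε / (4 * B)) with hη
  have hη0 : 0 < η := lt_min (by norm_num) (by positivity)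
  have hη1 : η ≤ 1 / 2 := min_le_left _ _
  set δ := η ^ (1 / p) with hδ
  have hδ0 : 0 < δ := Real.rpow_pos_of_pos hη0 _
  have hδp : δ ^ p = η := by
    rw [hδ, ← Real.rpow_mul hη0.le, one_div_mul_cancel hp0.ne', Real.rpow_one]
  have hgap : 2 * s * ρ + δ ^ p * (B / (1 - δ ^ p)) < b := by
    have h1 : B / (1 - η) ≤ 2 * B := by
      rw [div_le_iff₀ (by linarith)]; nlinarith
    have h2 : η * (4 * B) ≤ ε := (le_div_iff₀ (by positivity)).1 (min_le_right _ _)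
    have h3 := mul_le_mul_of_nonneg_left h1 hη0.le
    rw [hδp, hb]
    linarith
  obtain ⟨c₁, hc₁, hlow⟩ := exists_measure_sum_le_exp (ν := gaussianReal 0 1) (b := b)
    (measurable_truncPow p s) (by
      rw [integrableExpSet_gaussianReal_of_abs_le (measurable_truncPow p s)
        (abs_truncPow_le hp0 hp1 hs0.le)]; simp)
    (by rw [integral_truncPow hp0, hb, ← hs]; linarith)
  -- the upper tail of `∑ |x i| ^ p` is the lower tail of its negative
  obtain ⟨c₂, hc₂, hup⟩ := exists_measure_sum_le_exp (ν := gaussianReal 0 1)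
    (g := fun x => -|x| ^ p) (b := -B) (by fun_prop) (by
      rw [integrableExpSet_gaussianReal_of_abs_le (C := 1) (by fun_prop) fun x => by
        rw [abs_neg, abs_of_nonneg (Real.rpow_nonneg (abs_nonneg _) _)]
        exact rpow_abs_le_one_add_abs hp0 hp1 x]
      simp)
    (by rw [integral_neg]; linarith)
  set c := min c₁ c₂ with hc
  have hc0 : 0 < c := lt_min hc₁ hc₂
  set L := Real.log (1 + 2 / δ) with hL
  have hK : 1 < 1 + 2 / δ := lt_add_of_pos_right 1 (by positivity)
  have hL0 : 0 < L := Real.log_pos hK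
  -- with `c m ≥ (L + 2) n` the union bound is `2 exp (L n) exp (- c m) ≤ 2 exp (- 2 n)`
  refine ⟨(L + 2) / c, 1, by positivity, one_pos, 1, ?_⟩
  intro n m hn hnm Ω _ P _ A hA
  have hn' : (1 : ℝ) ≤ n := by exact_mod_cast hn
  have hcm : (L + 2) * n ≤ c * m := by
    rw [div_mul_eq_mul_div, div_le_iff₀ hc0] at hnm; linarith
  have hm : 0 < m := by
    rcases Nat.eq_zero_or_pos m with rfl | h
    · have : 0 < (L + 2) * n := by positivity
      simp only [Nat.cast_zero, mul_zero] at hcm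
      linarith
    · exact h
  obtain ⟨N, hN1, hNcard, hnet⟩ := exists_finset_net_sphere (EuclideanSpace ℝ (Fin n)) hδ0
  rw [finrank_euclideanSpace_fin] at hNcard
  set bad₁ : EuclideanSpace ℝ (Fin n) → Set Ω :=
    fun z => {ω | ∑ i, truncPow p s ((A ω).mulVec z i) ≤ b * m}
  set bad₂ : EuclideanSpace ℝ (Fin n) → Set Ω :=
    fun z => {ω | ∑ i, -|(A ω).mulVec z i| ^ p ≤ -B * m}
  set bad : Set Ω := ⋃ z ∈ N, (bad₁ z ∪ bad₂ z) with hbad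
  have hbad_le : P.real bad ≤ Real.exp (-1 * n) := by
    have hz : ∀ z ∈ N, P.real (bad₁ z ∪ bad₂ z) ≤ 2 * Real.exp (-c * m) := by
      intro z hz
      obtain ⟨hlaw, hind⟩ := hA.mulVec (hN1 z hz)
      have h1 : P.real (bad₁ z) ≤ Real.exp (-c₁ * m) := hlow m Ω P _ hlaw hind
      have h2 : P.real (bad₂ z) ≤ Real.exp (-c₂ * m) := hup m Ω P _ hlaw hind
      have h3 : Real.exp (-c₁ * m) ≤ Real.exp (-c * m) := by
        gcongr; exact min_le_left _ _
      have h4 : Real.exp (-c₂ * m) ≤ Real.exp (-c * m) := by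
        gcongr; exact min_le_right _ _
      have := measureReal_union_le (μ := P) (bad₁ z) (bad₂ z)
      linarith
    have hcard : (N.card : ℝ) ≤ Real.exp (L * n) := by
      rwa [mul_comm, Real.exp_nat_mul, hL, Real.exp_log (by linarith)]
    have h2 : (2 : ℝ) ≤ Real.exp n := by linarith [Real.add_one_le_exp (n : ℝ)]
    calc P.real bad ≤ ∑ z ∈ N, P.real (bad₁ z ∪ bad₂ z) := measureReal_biUnion_finset_le _ _
      _ ≤ ∑ z ∈ N, 2 * Real.exp (-c * m) := Finset.sum_le_sum hz
      _ = N.card * (2 * Real.exp (-c * m)) := by rw [Finset.sum_const, nsmul_eq_mul]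
      _ ≤ Real.exp (L * n) * (Real.exp n * Real.exp (-c * m)) := by gcongr
      _ = Real.exp (L * n + (n + -c * m)) := by rw [Real.exp_add, Real.exp_add]
      _ ≤ _ := Real.exp_le_exp.2 (by linarith)
  refine ⟨(toMeasurable P bad)ᶜ, (measurableSet_toMeasurable P bad).compl, ?_, fun ω hω => ?_⟩
  · rw [probReal_compl_eq_one_sub (measurableSet_toMeasurable P bad), Measure.real,
      measure_toMeasurable]
    exact sub_le_sub_left hbad_le 1
  · have hω' : ω ∉ bad := fun h => hω (subset_toMeasurable P bad h)
    simp only [hbad, mem_iUnion, not_exists, mem_union, not_or] at hω'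
    refine recoversAll_of_net hp0 hp1 hs0.le hm (by rw [hδp]; linarith) hgap hB0.le hnet
      (fun z hz => (not_le.1 (hω' z hz).1).le) fun z hz => ?_
    have : -B * m ≤ ∑ i, -|(A ω).mulVec z i| ^ p := (not_le.1 fun h => (hω' z hz).2 h).le
    rw [Finset.sum_neg_distrib] at this
    exact (by linarith : ∑ i, |(A ω).mulVec z i| ^ p ≤ B * m)
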